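/- Let $\mathbb F_q$ be a finite field. An ADT network consists of a finite set $\mathcal V$ of supernodes, where each supernode $V$ has a finite set $I(V)$ of input ports and a finite set $O(V)$ of output ports (all these sets are pairwise disjoint), and a set $\mathcal E$ of edges $(e,e')$, each from an output port $e$ to an input port $e'$. Suppose that the network is acyclic, i.e. the directed graph on $\mathcal V$ with an arc $V\to W$ whenever some edge goes from $O(V)$ to $I(W)$ has no directed cycle (in particular, no loop). Let $S\ne T$ be two supernodes (source and destination). A cut is a set $\Omega\subseteq\mathcal V$ with $S\in\Omega$ and $T\notin\Omega$. Its incidence matrix $G_\Omega$ is the $0$-$1$ matrix over $\mathbb F_q$ whose rows are the output ports of supernodes in $\Omega$ and whose columns are the input ports of supernodes not in $\Omega$, with entry $1$ at $(e,e')$ exactly if $(e,e')\in\mathcal E$. Put $$\mathrm{mincut}(S,T)=\min_\Omega \operatorname{rank}(G_\Omega).$$ Given coding coefficients $\alpha_{(k,e)},\beta_{(e',e)},\epsilon_{(e',l)}\in\mathbb F_q$, and numbers $\mu$ of source processes and $\nu$ of destination processes, let $F$, indexed by pairs of ports, have the entries $F_{e,e'}=1$ if $(e,e')\in\mathcal E$,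 $F_{e',e}=\beta_{(e',e)}$ if $e'\in I(V)$ and $e\in O(V)$ for some supernode $V$, and $0$ otherwise. Let $A$ (with $\mu$ rows, and columns indexed by ports) have the entries $\alpha_{(k,e)}$ if $e\in O(S)$ and $0$ otherwise. Let $B$ (with $\nu$ rows, and columns indexed by ports) have the entries $\epsilon_{(e',l)}$, in row $l$ and column $e'$, if $e'\in I(T)$ and $0$ otherwise. Then $I-F$ is invertible for every choice of $\beta$, so that the system matrix $M=A(I-F)^{-1}B^{T}$ is defined, and for all $\mu,\nu\ge \mathrm{mincut}(S,T)$, $$\mathrm{mincut}(S,T)=\min_\Omega \operatorname{rank}(G_\Omega)=\max_{\alpha,\beta,\epsilon}\operatorname{rank}(M),$$ where the maximum is over all choices of the coefficients $\alpha,\beta,\epsilon$ in $\mathbb F_q$ and is attained. -/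

import Mathlib

/-- An ADT network with supernode set `V`, input ports `I` and output ports `O`. Every port belongs
to a supernode, so `I(v)` and `O(v)` are the fibres of `inNode` and `outNode` over `v`; an edge goes
from an output port to an input port. -/
structure ADTNetwork (V I O : Type*) where
  /-- the supernode to which an input port belongs -/
  inNode : I → V
  /-- the supernode to which an output port belongs -/
  outNode : O → V
  /-- the edge set -/
  edges : Finset (O × I)

namespace ADTNetwork

/-- Some edge goes from an output port of `v` to an input port of `w`. -/
def Link {V I O : Type*} (N : ADTNetwork V I O) (v w : V) : Prop :=
  ∃ e ∈ N.edges, N.outNode e.1 = v ∧ N.inNode e.2 = w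

/-- The network has no directed cycle (of length at least one) of supernodes. -/
def Acyclic {V I O : Type*} (N : ADTNetwork V I O) : Prop :=
  ∀ v : V, ¬ Relation.TransGen N.Link v v

/-- `Ω` is (the source side of) a cut between `S` and `T`. -/
def IsCut {V : Type*} (S T : V) (Ω : Finset V) : Prop :=
  S ∈ Ω ∧ T ∉ Ω

/-- The incidence matrix `G_Ω`, whose rows are the output ports in `Ω` and whose columns are the
input ports outside `Ω`. -/
def cutMatrix {V I O : Type*} [DecidableEq I] [DecidableEq O] (N : ADTNetwork V I O)
    (K : Type*) [Field K] (Ω : Finset V) :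
    Matrix {o : O // N.outNode o ∈ Ω} {i : I // N.inNode i ∉ Ω} K :=
  Matrix.of fun o i => if (o.1, i.1) ∈ N.edges then 1 else 0

/-- The set of values `rank G_Ω` over all cuts `Ω` between `S` and `T`. -/
def cutValues {V I O : Type*} [DecidableEq V] [Fintype I] [DecidableEq I] [DecidableEq O]
    (N : ADTNetwork V I O) (K : Type*) [Field K] (S T : V) : Set ℕ :=
  {r | ∃ Ω : Finset V, IsCut S T Ω ∧ r = (N.cutMatrix K Ω).rank}

/-- `mincut(S, T)`, the minimum of `rank G_Ω` over all cuts between `S` and `T`. -/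
noncomputable def mincut {V I O : Type*} [DecidableEq V] [Fintype I] [DecidableEq I]
    [DecidableEq O] (N : ADTNetwork V I O) (K : Type*) [Field K] (S T : V) : ℕ :=
  sInf (N.cutValues K S T)

/-- The adjacency matrix `F`, indexed by all ports. Only the coefficients `β e' e` for which `e'`
and `e` are ports of the same supernode are used. -/
def adjMatrix {V I O : Type*} [DecidableEq V] [DecidableEq I] [DecidableEq O]
    (N : ADTNetwork V I O) {K : Type*} [Field K] (β : I → O → K) : Matrix (I ⊕ O) (I ⊕ O) K :=
  Matrix.of fun
    | .inr o, .inl i => if (o, i) ∈ N.edges then 1 else 0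
    | .inl i, .inr o => if N.inNode i = N.outNode o then β i o else 0
    | .inl _, .inl _ => 0
    | .inr _, .inr _ => 0

/-- The encoding matrix `A` of the source `S`, for `m` source processes. -/
def encMatrix {V I O : Type*} [DecidableEq V] (N : ADTNetwork V I O) {K : Type*} [Field K]
    (S : V) {m : ℕ} (α : Fin m → O → K) : Matrix (Fin m) (I ⊕ O) K :=
  Matrix.of fun
    | k, .inr o => if N.outNode o = S then α k o else 0
    | _, .inl _ => 0

/-- The decoding matrix `B` of the destination `T`, for `n` destination processes. -/
def decMatrix {V I O : Type*} [DecidableEq V] (N : ADTNetwork V I O) {K : Type*} [Field K]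
    (T : V) {n : ℕ} (ε : I → Fin n → K) : Matrix (Fin n) (I ⊕ O) K :=
  Matrix.of fun
    | k, .inl i => if N.inNode i = T then ε i k else 0
    | _, .inr _ => 0

/-- The system matrix `M = A (1 - F)⁻¹ Bᵀ`. -/
noncomputable def systemMatrix {V I O : Type*} [DecidableEq V] [Fintype I] [DecidableEq I]
    [Fintype O] [DecidableEq O] (N : ADTNetwork V I O) {K : Type*} [Field K] (S T : V) {m n : ℕ}
    (α : Fin m → O → K) (β : I → O → K) (ε : I → Fin n → K) : Matrix (Fin m) (Fin n) K :=
  N.encMatrix S α * (1 - N.adjMatrix β)⁻¹ * (N.decMatrix T ε).transpose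

end ADTNetwork

/-! Upper bound: let `P` project onto the ports of a cut. Then `A = A P` and `Bᵀ = (1 - P) Bᵀ`,
while `P (1 - F)⁻¹ (1 - P)` factors through `P F (1 - P)`, which is `G_Ω` padded by zeros
(`rank_systemMatrix_le`).

Lower bound: let `E` be the incidence matrix of all outputs against all inputs. The transfer matrix
from outputs to inputs is `W = E (1 - β E)⁻¹`. The rows of `β` at inputs outside `T` are fixed one
at a time, in any order, so that for every cut `Ω` the space `cutSpan` keeps dimension at least `r`
plus the number of settled inputs. Initially this says `r ≤ rank G_Ω`. When all inputs outside `T`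
are processed, the case `Ω = {S}`, pulled back along `1 - β E`, bounds the rank of the `S`-`T` block
of `W` from below (`exists_coding_rank_ge`).

A choice for input `j` can fail only at a tight cut. By submodularity tight cuts are closed under
union, and so either the unit vector `e j` or some `e j - a u` succeeds (`exists_vector_for_input`).
The only coefficients are 0 and 1, so the field may be arbitrarily small. -/

namespace ADTNetwork

open Module Submodule

/-! ### Cut spans, tight cuts and the choice of one vector. -/

section Step

variable {K V I O W : Type*} [Field K] [AddCommGroup W] [Module K W]

/-- The space spanned by the output vectors in `Ω`, the input vectors in `Ω` and `Z`. -/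
def cutSpan (K : Type*) [Field K] [Module K W] (p : O → V) (q : I → V) (a : O → W) (e : I → W)
    (Z : Submodule K W) (Ω : Finset V) : Submodule K W :=
  span K (a '' {o | p o ∈ Ω}) ⊔ span K (e '' {i | q i ∈ Ω}) ⊔ Z

variable {p : O → V} {q : I → V} {a : O → W} {e : I → W} {Z : Submodule K W} {Ω Ω' : Finset V}

theorem cutSpan_le {P : Submodule K W} (ha : ∀ o, p o ∈ Ω → a o ∈ P)
    (he : ∀ i, q i ∈ Ω → e i ∈ P) (hZ : Z ≤ P) : cutSpan K p q a e Z Ω ≤ P := by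
  refine sup_le (sup_le ?_ ?_) hZ <;> rw [span_le] <;> rintro _ ⟨x, hx, rfl⟩
  exacts [ha x hx, he x hx]

theorem out_mem_cutSpan {o : O} (ho : p o ∈ Ω) : a o ∈ cutSpan K p q a e Z Ω :=
  mem_sup_left (mem_sup_left (subset_span ⟨o, ho, rfl⟩))

theorem in_mem_cutSpan {i : I} (hi : q i ∈ Ω) : e i ∈ cutSpan K p q a e Z Ω :=
  mem_sup_left (mem_sup_right (subset_span ⟨i, hi, rfl⟩))

theorem le_cutSpan : Z ≤ cutSpan K p q a e Z Ω := le_sup_right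

theorem cutSpan_mono (h : Ω ⊆ Ω') : cutSpan K p q a e Z Ω ≤ cutSpan K p q a e Z Ω' :=
  cutSpan_le (fun _ ho => out_mem_cutSpan (h ho)) (fun _ hi => in_mem_cutSpan (h hi)) le_cutSpan

variable [DecidableEq V]

theorem cutSpan_union :
    cutSpan K p q a e Z (Ω ∪ Ω') = cutSpan K p q a e Z Ω ⊔ cutSpan K p q a e Z Ω' := by
  refine le_antisymm (cutSpan_le ?_ ?_ (le_cutSpan.trans le_sup_left))
    (sup_le (cutSpan_mono Finset.subset_union_left) (cutSpan_mono Finset.subset_union_right))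
  · intro o ho
    rcases Finset.mem_union.1 ho with h | h
    exacts [mem_sup_left (out_mem_cutSpan h), mem_sup_right (out_mem_cutSpan h)]
  · intro i hi
    rcases Finset.mem_union.1 hi with h | h
    exacts [mem_sup_left (in_mem_cutSpan h), mem_sup_right (in_mem_cutSpan h)]

variable [Fintype I] [DecidableEq I]

/-- The input ports that lie in `Ω` or have been marked as processed. -/
def settled (q : I → V) (D : Finset I) (Ω : Finset V) : Finset I :=
  {i | q i ∈ Ω ∨ i ∈ D}

theorem card_settled_union_add_inter (q : I → V) (D : Finset I) (Ω Ω' : Finset V) :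
    (settled q D (Ω ∪ Ω')).card + (settled q D (Ω ∩ Ω')).card =
      (settled q D Ω).card + (settled q D Ω').card := by
  rw [← Finset.card_union_add_card_inter (settled q D Ω)]
  congr 2 <;> ext i <;> simp [settled] <;> tauto

theorem card_settled_insert {D : Finset I} {j : I} (hj : j ∉ D) (hΩ : q j ∉ Ω) :
    (settled q (insert j D) Ω).card = (settled q D Ω).card + 1 := by
  rw [← Finset.card_insert_of_notMem (a := j) (by simp [settled, hj, hΩ])]
  congr 1
  ext i
  simp [settled]
  tauto

/-- `Ω` is a tight cut not containing the supernode of `j`, whose span contains `z`; it prevents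
`z` from being the vector assigned to `j`. -/
def Obstructs (K : Type*) [Field K] [Module K W] (p : O → V) (q : I → V) (a : O → W) (e : I → W)
    (Z : Submodule K W) (S T : V) (r : ℕ) (D : Finset I) (j : I) (z : W) (Ω : Finset V) : Prop :=
  IsCut S T Ω ∧ q j ∉ Ω ∧ finrank K (cutSpan K p q a e Z Ω) = r + (settled q D Ω).card ∧
    z ∈ cutSpan K p q a e Z Ω

variable [FiniteDimensional K W] {S T : V} {r : ℕ} {D : Finset I}

/-- The required bound grows, by one, only if `Ω` misses the supernode of `j`. Then either the old
inequality had slack, or `Ω` was tight and `z` is a new direction. -/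
theorem le_finrank_of_not_obstructs {j : I} (hj : j ∉ D) {z : W} (hΩ : IsCut S T Ω)
    (h : r + (settled q D Ω).card ≤ finrank K (cutSpan K p q a e Z Ω))
    (hz : ¬ Obstructs K p q a e Z S T r D j z Ω) :
    r + (settled q (insert j D) Ω).card ≤ finrank K ↥(cutSpan K p q a e (Z ⊔ span K {z}) Ω) := by
  have hs : cutSpan K p q a e (Z ⊔ span K {z}) Ω = cutSpan K p q a e Z Ω ⊔ span K {z} := by
    simp [cutSpan, sup_assoc]
  rw [hs]
  by_cases hv : q j ∈ Ω
  · have : settled q (insert j D) Ω = settled q D Ω := by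
      ext i
      simp only [settled, Finset.mem_filter, Finset.mem_univ, true_and, Finset.mem_insert]
      refine ⟨?_, by tauto⟩
      rintro (h | rfl | h) <;> tauto
    rw [this]
    exact h.trans (finrank_mono le_sup_left)
  · rw [card_settled_insert hj hv]
    by_cases hm : z ∈ cutSpan K p q a e Z Ω
    · have : finrank K (cutSpan K p q a e Z Ω) ≠ r + (settled q D Ω).card := fun h' =>
        hz ⟨hΩ, hv, h', hm⟩
      have h2 := finrank_mono (R := K) (le_sup_left : cutSpan K p q a e Z Ω ≤
        cutSpan K p q a e Z Ω ⊔ span K {z})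
      omega
    · have : finrank K (cutSpan K p q a e Z Ω) <
          finrank K ↥(cutSpan K p q a e Z Ω ⊔ span K {z}) := by
        refine finrank_lt_finrank_of_lt (lt_of_le_of_ne le_sup_left fun h' => hm ?_)
        rw [h']
        exact mem_sup_right (mem_span_singleton_self z)
      omega

/-- An uncrossing argument on a maximal tight cut that obstructs `e j`. Hypothesis `hZ` says that a
processed input adds no dimension once the outputs of its supernode are present. -/
theorem exists_vector_for_input [Finite V]
    (hZ : ∀ i ∈ D, e i ∈ Z ⊔ span K (a '' {o | p o = q i}))
    (h : ∀ Ω, IsCut S T Ω → r + (settled q D Ω).card ≤ finrank K (cutSpan K p q a e Z Ω))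
    {j : I} (hj : j ∉ D) (hT : q j ≠ T) :
    ∃ z, (z = e j ∨ ∃ u, p u = q j ∧ z = e j - a u) ∧ ∀ Ω, IsCut S T Ω →
      r + (settled q (insert j D) Ω).card ≤
        finrank K ↥(cutSpan K p q a e (Z ⊔ span K {z}) Ω) := by
  by_cases h0 : ∃ Ω, Obstructs K p q a e Z S T r D j (e j) Ω
  swap
  · exact ⟨e j, .inl rfl, fun Ω hΩ =>
      le_finrank_of_not_obstructs hj hΩ (h Ω hΩ) fun hb => h0 ⟨Ω, hb⟩⟩
  obtain ⟨Ω₀, hΩ₀⟩ := h0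
  obtain ⟨Ω, -, ⟨hΩ, hv, ht, he⟩, hmax⟩ := Finite.exists_le_maximal hΩ₀
  -- Otherwise adding the supernode of `j` to `Ω` gains dimension only from the newly settled inputs
  -- other than `j`, one too few for the enlarged cut.
  obtain ⟨u, hu, hau⟩ : ∃ u, p u = q j ∧ a u ∉ cutSpan K p q a e Z Ω := by
    by_contra! hc
    have hcut : IsCut S T (insert (q j) Ω) :=
      ⟨Finset.mem_insert_of_mem hΩ.1, by simp [hΩ.2, hT.symm]⟩
    have hle := h _ hcut
    set N : Finset I := (settled q D (insert (q j) Ω) \ settled q D Ω).erase j with hN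
    have hsub : cutSpan K p q a e Z (insert (q j) Ω) ≤
        cutSpan K p q a e Z Ω ⊔ span K (e '' N) := by
      refine cutSpan_le ?_ ?_ (le_cutSpan.trans le_sup_left)
      · intro o ho
        rcases Finset.mem_insert.1 ho with ho | ho
        exacts [mem_sup_left (hc o ho), mem_sup_left (out_mem_cutSpan ho)]
      · intro i hi
        by_cases hiΩ : q i ∈ Ω
        · exact mem_sup_left (in_mem_cutSpan hiΩ)
        have hiv : q i = q j := (Finset.mem_insert.1 hi).resolve_right hiΩ
        by_cases hiD : i ∈ D
        · refine mem_sup_left ((sup_le le_cutSpan (span_le.2 ?_) : Z ⊔ _ ≤ _) (hZ i hiD))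
          rintro _ ⟨o, ho, rfl⟩
          exact hc o (Eq.trans ho hiv)
        by_cases hij : i = j
        · exact hij ▸ mem_sup_left he
        · refine mem_sup_right (subset_span ⟨i, ?_, rfl⟩)
          simp [hN, settled, hij, hiD, hiv, hv]
    have hjm : j ∈ settled q D (insert (q j) Ω) \ settled q D Ω := by
      simp [settled, hj, hv]
    have hmono : settled q D Ω ⊆ settled q D (insert (q j) Ω) := by
      intro i
      simp only [settled, Finset.mem_filter, Finset.mem_univ, true_and, Finset.mem_insert]
      tauto
    have hcard := Finset.card_erase_add_one hjm
    rw [← hN, Finset.card_sdiff_of_subset hmono] at hcard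
    have hN' : finrank K (span K (e '' (N : Set I))) ≤ N.card := by
      classical
      rw [← Finset.coe_image]
      exact (finrank_span_finset_le_card _).trans Finset.card_image_le
    have h1 := finrank_mono (R := K) hsub
    have h2 := Submodule.finrank_add_le_finrank_add_finrank (cutSpan K p q a e Z Ω)
      (span K (e '' (N : Set I)))
    have h3 := Finset.card_le_card hmono
    omega
  refine ⟨e j - a u, .inr ⟨u, hu, rfl⟩, fun Ω₂ hΩ₂ =>
    le_finrank_of_not_obstructs hj hΩ₂ (h Ω₂ hΩ₂) ?_⟩
  rintro ⟨-, hv₂, ht₂, he₂⟩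
  have hcu : IsCut S T (Ω ∪ Ω₂) :=
    ⟨Finset.mem_union_left _ hΩ.1, by simp [hΩ.2, hΩ₂.2]⟩
  have hci : IsCut S T (Ω ∩ Ω₂) :=
    ⟨Finset.mem_inter.2 ⟨hΩ.1, hΩ₂.1⟩, by simp [hΩ.2]⟩
  have h1 := h _ hcu
  have h2 := h _ hci
  have h3 := card_settled_union_add_inter q D Ω Ω₂
  have h4 := Submodule.finrank_sup_add_finrank_inf_eq (cutSpan K p q a e Z Ω)
    (cutSpan K p q a e Z Ω₂)
  have h5 := finrank_mono (R := K) (le_inf (cutSpan_mono Finset.inter_subset_left)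
    (cutSpan_mono Finset.inter_subset_right) : cutSpan K p q a e Z (Ω ∩ Ω₂) ≤
      cutSpan K p q a e Z Ω ⊓ cutSpan K p q a e Z Ω₂)
  rw [← cutSpan_union] at h4
  -- Dimension is submodular and the settled count modular, so the union of two tight cuts is tight.
  -- Maximality then forces `Ω₂ ⊆ Ω`, which puts `a u` in the span of `Ω`.
  have hob : Obstructs K p q a e Z S T r D j (e j) (Ω ∪ Ω₂) :=
    ⟨hcu, by simp [hv, hv₂], by omega, cutSpan_mono Finset.subset_union_left he⟩
  have hsub : Ω₂ ⊆ Ω := Finset.subset_union_right.trans (hmax hob Finset.subset_union_left)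
  have := sub_mem he (cutSpan_mono hsub he₂)
  rw [sub_sub_cancel] at this
  exact hau this

end Step

/-! ### Ranks of submatrices as dimensions of spans. -/

section Ranks

variable {K V I O : Type*} [Field K] [Fintype I] [DecidableEq I]

theorem finrank_span_single (C : Finset I) :
    finrank K (span K ((fun i => (Pi.single i 1 : I → K)) '' C)) = C.card := by
  have h : LinearIndependent K (fun i => (Pi.single i 1 : I → K)) := by
    convert (Pi.basisFun K I).linearIndependent using 1
    ext i
    simp
  have h2 := finrank_span_eq_card (h.comp (Subtype.val : C → I) Subtype.val_injective)
  have h3 : Set.range ((fun i => (Pi.single i 1 : I → K)) ∘ (Subtype.val : C → I)) =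
      (fun i => (Pi.single i 1 : I → K)) '' C := by
    rw [Set.range_comp, Subtype.range_coe]
  rw [← h3, h2, Fintype.card_coe]

theorem ker_funLeft_notMem (C : Finset I) :
    LinearMap.ker (LinearMap.funLeft K K (Subtype.val : {i // i ∉ C} → I)) =
      span K ((fun i => (Pi.single i 1 : I → K)) '' C) := by
  apply le_antisymm
  · intro x hx
    rw [pi_eq_sum_univ' x]
    refine sum_mem fun i _ => ?_
    by_cases hi : i ∈ C
    · refine smul_mem _ _ (subset_span ⟨i, hi, ?_⟩)
      ext k
      simp [Pi.single_apply, eq_comm]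
    · have : x i = 0 := congrFun hx ⟨i, hi⟩
      simp [this]
  · rw [span_le]
    rintro _ ⟨i, hi, rfl⟩
    ext ⟨k, hk⟩
    simp only [LinearMap.funLeft_apply, Pi.zero_apply]
    exact Pi.single_eq_of_ne (by rintro rfl; exact hk hi) _

/-- Rank-nullity for the map forgetting the coordinates in `C`: its kernel is spanned by the unit
vectors, its image by the rows of the submatrix. -/
theorem finrank_span_rows_sup_span_single [Finite O] (A : Matrix O I K) (P : O → Prop)
    (C : Finset I) :
    finrank K ↥(span K (A.row '' {o | P o}) ⊔ span K ((fun i => (Pi.single i 1 : I → K)) '' C)) =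
      (A.submatrix (Subtype.val : {o // P o} → O) (Subtype.val : {i // i ∉ C} → I)).rank +
        C.card := by
  set π := LinearMap.funLeft K K (Subtype.val : {i // i ∉ C} → I) with hπ
  set H := span K (A.row '' {o | P o}) ⊔ span K ((fun i => (Pi.single i 1 : I → K)) '' C) with hH
  have hk : LinearMap.ker π ≤ H := by
    rw [hπ, ker_funLeft_notMem]
    exact le_sup_right
  have h1 := (π.domRestrict H).finrank_range_add_finrank_ker
  have h2 : finrank K (LinearMap.ker (π.domRestrict H)) = C.card := by
    rw [← finrank_span_single (K := K) C, ← ker_funLeft_notMem, ← hπ, LinearMap.ker_domRestrict]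
    exact (comapSubtypeEquivOfLe hk).finrank_eq
  have h3 : LinearMap.range (π.domRestrict H) = span K (Set.range (A.submatrix
      (Subtype.val : {o // P o} → O) (Subtype.val : {i // i ∉ C} → I)).row) := by
    rw [LinearMap.range_domRestrict, hH, Submodule.map_sup, ← ker_funLeft_notMem, ← hπ,
      (LinearMap.le_ker_iff_map).1 le_rfl, sup_bot_eq, map_span, Set.image_image,
      ← Subtype.range_coe_subtype (p := P), ← Set.range_comp]
    rfl
  rw [Matrix.rank_eq_finrank_span_row, ← h3, ← h1, h2]

theorem exists_rows_rank_eq {R C : Type*} [Finite R] [Fintype C] (A : Matrix R C K) {r : ℕ}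
    (hr : r ≤ A.rank) : ∃ f : Fin r → R, (A.submatrix f id).rank = r := by
  obtain ⟨f, hf, -, hli⟩ := exists_fun_fin_finrank_span_eq K (Set.range A.row)
  rw [Matrix.rank_eq_finrank_span_row] at hr
  choose g hg using hf
  have hli' : LinearIndependent K (A.submatrix (g ∘ Fin.castLE hr) id).row := by
    have h : (A.submatrix (g ∘ Fin.castLE hr) id).row = f ∘ Fin.castLE hr := by
      funext k
      exact hg _
    rw [h]
    exact hli.comp (Fin.castLE hr) (Fin.castLE_injective hr)
  exact ⟨g ∘ Fin.castLE hr, by simpa using hli'.rank_matrix⟩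

theorem exists_submatrix_rank_eq {R C : Type*} [Finite R] [Fintype C] (A : Matrix R C K) {r : ℕ}
    (hr : r ≤ A.rank) :
    ∃ (f : Fin r → R) (g : Fin r → C), (A.submatrix f g).rank = r := by
  obtain ⟨f, hf⟩ := exists_rows_rank_eq A hr
  obtain ⟨g, hg⟩ := exists_rows_rank_eq (A.submatrix f id).transpose
    (by rw [Matrix.rank_transpose, hf])
  refine ⟨f, g, ?_⟩
  exact (Matrix.rank_transpose _).symm.trans hg

end Ranks

/-! ### Building the coding matrix row by row. -/

section Induction

variable {K V I O : Type*} [Field K] [Fintype I] [DecidableEq I] [Fintype O] [DecidableEq V]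
  [Finite V]

/-- Row `i` of `1 - β * E`. -/
def reducedRow (E : Matrix O I K) (β : I → O → K) (i : I) : I → K :=
  Pi.single i 1 - ∑ o, β i o • E.row o

theorem exists_coding (p : O → V) (q : I → V) (E : Matrix O I K) {S T : V} {r : ℕ}
    (h : ∀ Ω, IsCut S T Ω → r + (settled q ∅ Ω).card ≤
      finrank K (cutSpan K p q E.row (fun i => Pi.single i 1) ⊥ Ω)) (D : Finset I)
    (hD : ∀ i ∈ D, q i ≠ T) :
    ∃ β : I → O → K, (∀ i o, q i ≠ p o → β i o = 0) ∧
      ∀ Ω, IsCut S T Ω → r + (settled q D Ω).card ≤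
        finrank K (cutSpan K p q E.row (fun i => Pi.single i 1)
          (span K (reducedRow E β '' D)) Ω) := by
  classical
  induction D using Finset.induction_on with
  | empty => exact ⟨0, by simp, fun Ω hΩ => by
      rw [show span K (reducedRow E 0 '' ↑(∅ : Finset I)) = ⊥ by simp]
      exact h Ω hΩ⟩
  | insert j D hj ih =>
    obtain ⟨β, hβ, hr⟩ := ih fun i hi => hD i (Finset.mem_insert_of_mem hi)
    have hZ : ∀ i ∈ D, (Pi.single i 1 : I → K) ∈
        span K (reducedRow E β '' D) ⊔ span K (E.row '' {o | p o = q i}) := by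
      intro i hi
      have : (Pi.single i 1 : I → K) = reducedRow E β i + ∑ o, β i o • E.row o := by
        simp [reducedRow]
      rw [this]
      refine add_mem (mem_sup_left (subset_span ⟨i, hi, rfl⟩))
        (mem_sup_right (sum_mem fun o _ => ?_))
      by_cases ho : p o = q i
      · exact smul_mem _ _ (subset_span ⟨o, ho, rfl⟩)
      · rw [hβ i o (Ne.symm ho), zero_smul]
        exact zero_mem _
    obtain ⟨z, hz, hzr⟩ := exists_vector_for_input hZ hr hj (hD j (Finset.mem_insert_self j D))
    obtain ⟨b, hb, hbz⟩ : ∃ b : O → K, (∀ o, q j ≠ p o → b o = 0) ∧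
        z = Pi.single j 1 - ∑ o, b o • E.row o := by
      rcases hz with rfl | ⟨u, hu, rfl⟩
      · exact ⟨0, by simp, by simp⟩
      · refine ⟨Pi.single u 1, fun o ho => Pi.single_eq_of_ne (by rintro rfl; exact ho hu.symm) _,
          ?_⟩
        classical rw [Fintype.sum_eq_single u (fun o ho => by simp [ho])]; simp
    -- Only row `j` changes, and `j ∉ D`, so the reduced rows already chosen survive.
    refine ⟨Function.update β j b, ?_, ?_⟩
    · intro i o hio
      by_cases hij : i = j
      · subst hij
        simpa using hb o hio
      · simpa [hij] using hβ i o hio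
    · have hspan : span K (reducedRow E (Function.update β j b) '' ↑(insert j D)) =
          span K (reducedRow E β '' D) ⊔ span K {z} := by
        rw [Finset.coe_insert, Set.image_insert_eq, span_insert, sup_comm]
        congr 2
        · refine Set.image_congr fun i hi => ?_
          have : i ≠ j := fun h => hj (h ▸ hi)
          simp [reducedRow, this]
        · simp [reducedRow, hbz]
      rw [hspan]
      exact hzr

end Induction

/-! ### Acyclicity and invertibility. -/

section Acyclic

variable {K V I O : Type*} [Field K]

theorem isUnit_one_sub_of_lt {X : Type*} [Fintype X] [DecidableEq X] (F : Matrix X X K)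
    (g : X → ℕ) (h : ∀ x y, F x y ≠ 0 → g x < g y) : IsUnit (1 - F) := by
  rw [Matrix.isUnit_iff_isUnit_det]
  have hb : (1 - F).BlockTriangular g := by
    intro x y hxy
    have h1 : F x y = 0 := by
      by_contra hF
      exact absurd (h x y hF) (by omega)
    have h2 : x ≠ y := by rintro rfl; exact lt_irrefl _ hxy
    simp [h1, h2]
  rw [hb.det]
  have h1 : ∀ a, (1 - F).toSquareBlock g a = 1 := by
    intro a
    ext ⟨x, hx⟩ ⟨y, hy⟩
    have : F x y = 0 := by
      by_contra hF
      exact absurd (h x y hF) (by omega)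
    simp [Matrix.toSquareBlock_def, this, Matrix.one_apply]
  simp [h1]

theorem Acyclic.exists_height [Finite V] {N : ADTNetwork V I O} (hN : N.Acyclic) :
    ∃ h : V → ℕ, ∀ v w, N.Link v w → h v < h w := by
  refine ⟨fun v => {u | Relation.TransGen N.Link u v}.ncard, fun v w hvw => ?_⟩
  refine Set.ncard_lt_ncard ?_ (Set.toFinite _)
  refine ⟨fun u hu => Relation.TransGen.tail hu hvw, fun hsub => hN v (hsub ?_)⟩
  exact Relation.TransGen.single hvw

variable [DecidableEq V] [DecidableEq I] [DecidableEq O]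

/-- The supernode of a port. -/
def portNode (N : ADTNetwork V I O) : I ⊕ O → V := Sum.elim N.inNode N.outNode

theorem Acyclic.exists_port_height [Finite V] {N : ADTNetwork V I O} (hN : N.Acyclic) :
    ∃ g : I ⊕ O → ℕ, ∀ (β : I → O → K) x y, N.adjMatrix β x y ≠ 0 → g x < g y := by
  obtain ⟨h, hh⟩ := hN.exists_height
  -- Doubling leaves room for inputs to precede outputs within one supernode while every edge still
  -- goes up.
  refine ⟨Sum.elim (fun i => 2 * h (N.inNode i)) (fun o => 2 * h (N.outNode o) + 1), ?_⟩
  rintro β (i | o) (i' | o') hF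
  · simp [adjMatrix] at hF
  · simp only [adjMatrix, Matrix.of_apply, ne_eq, ite_eq_right_iff, Classical.not_imp] at hF
    simp [hF.1]
  · simp only [adjMatrix, Matrix.of_apply, ne_eq, ite_eq_right_iff, Classical.not_imp] at hF
    have : h (N.outNode o) < h (N.inNode i') := hh _ _ ⟨(o, i'), hF.1, rfl, rfl⟩
    simp only [Sum.elim_inl, Sum.elim_inr]
    omega
  · simp [adjMatrix] at hF

/-- The projection onto the ports in `Ω`. -/
def cutProj (N : ADTNetwork V I O) (K : Type*) [Field K] (Ω : Finset V) :
    Matrix (I ⊕ O) (I ⊕ O) K :=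
  Matrix.diagonal fun x => if N.portNode x ∈ Ω then 1 else 0

theorem one_sub_cutProj (N : ADTNetwork V I O) (Ω : Finset V) :
    1 - N.cutProj K Ω = Matrix.diagonal fun x => if N.portNode x ∈ Ω then 0 else 1 := by
  rw [cutProj, ← Matrix.diagonal_one, Matrix.diagonal_sub]
  congr 1
  ext x
  split_ifs <;> simp

end Acyclic

/-! ### Every cut bounds the rank of the system matrix. -/

section UpperBound

variable {K V I O : Type*} [Field K] [DecidableEq V] [Fintype I] [DecidableEq I]
  [Fintype O] [DecidableEq O]

theorem isUnit_one_sub_adjMatrix [Finite V] {N : ADTNetwork V I O} (hN : N.Acyclic) (β : I → O → K) :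
    IsUnit (1 - N.adjMatrix β) := by
  obtain ⟨g, hg⟩ := hN.exists_port_height (K := K)
  exact isUnit_one_sub_of_lt _ g (hg β)

/-- Coding coefficients stay inside a supernode, so only edges cross the cut. -/
theorem rank_cutProj_adjMatrix_le (N : ADTNetwork V I O) (β : I → O → K) (Ω : Finset V) :
    (N.cutProj K Ω * N.adjMatrix β * (1 - N.cutProj K Ω)).rank ≤ (N.cutMatrix K Ω).rank := by
  have h : N.cutProj K Ω * N.adjMatrix β * (1 - N.cutProj K Ω) =
      (1 : Matrix (I ⊕ O) (I ⊕ O) K).submatrix id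
          (fun o : {o : O // N.outNode o ∈ Ω} => Sum.inr o.1) * N.cutMatrix K Ω *
        (1 : Matrix (I ⊕ O) (I ⊕ O) K).submatrix
          (fun i : {i : I // N.inNode i ∉ Ω} => Sum.inl i.1) id := by
    rw [one_sub_cutProj, cutProj]
    ext x y
    rw [Matrix.mul_diagonal, Matrix.diagonal_mul, Matrix.mul_apply]
    simp only [Matrix.mul_apply]
    rcases x with i | o <;> rcases y with i' | o'
    · simp [adjMatrix, Matrix.one_apply]
    · by_cases hi : N.inNode i = N.outNode o'
      · by_cases ho : N.outNode o' ∈ Ω <;>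
          simp [portNode, hi, ho]
      · simp [adjMatrix, hi]
    · by_cases ho : N.outNode o ∈ Ω
      · by_cases hi : N.inNode i' ∈ Ω
        · simp only [portNode, Sum.elim_inl, hi, if_true, mul_zero]
          symm
          refine Finset.sum_eq_zero fun k _ => ?_
          have : k.1 ≠ i' := by rintro rfl; exact k.2 hi
          simp [this]
        · rw [Fintype.sum_eq_single ⟨i', hi⟩, Fintype.sum_eq_single ⟨o, ho⟩]
          · simp [portNode, hi, ho, adjMatrix, cutMatrix, Matrix.one_apply]
          · rintro ⟨k, hk⟩ hne
            have : o ≠ k := by rintro rfl; exact hne rfl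
            simp [this]
          · rintro ⟨k, hk⟩ hne
            have : k ≠ i' := by rintro rfl; exact hne rfl
            simp [Matrix.one_apply, this]
      · simp only [portNode, Sum.elim_inr, ho, if_false, zero_mul]
        symm
        refine Finset.sum_eq_zero fun k _ => ?_
        rw [Finset.sum_eq_zero, zero_mul]
        rintro l -
        have : o ≠ l.1 := by rintro rfl; exact ho l.2
        simp [this]
    · simp [adjMatrix, Matrix.one_apply]
  rw [h]
  exact (Matrix.rank_mul_le_left _ _).trans (Matrix.rank_mul_le_right _ _)

theorem rank_systemMatrix_le [Finite V] {N : ADTNetwork V I O} (hN : N.Acyclic) {S T : V}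
    {Ω : Finset V} (hΩ : IsCut S T Ω) {m n : ℕ} (α : Fin m → O → K) (β : I → O → K) (ε : I → Fin n → K) :
    (N.systemMatrix S T α β ε).rank ≤ (N.cutMatrix K Ω).rank := by
  set P := N.cutProj K Ω with hP
  set F := N.adjMatrix β with hF
  set X := (1 - F)⁻¹ with hX
  have hPP : P * P = P := by
    rw [hP, cutProj, Matrix.diagonal_mul_diagonal]
    congr 1
    ext x
    split_ifs <;> simp
  have hA : N.encMatrix S α * P = N.encMatrix S α := by
    ext k x
    rw [hP, cutProj, Matrix.mul_diagonal]
    rcases x with i | o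
    · simp [encMatrix]
    · by_cases ho : N.outNode o = S <;> simp [encMatrix, ho, portNode, hΩ.1]
  have hB : (1 - P) * (N.decMatrix T ε).transpose = (N.decMatrix T ε).transpose := by
    ext x k
    rw [hP, one_sub_cutProj, Matrix.diagonal_mul]
    rcases x with i | o
    · by_cases hi : N.inNode i = T <;> simp [decMatrix, hi, portNode, hΩ.2]
    · simp [decMatrix]
  have hXF : X = 1 + F * X := by
    have := Matrix.mul_nonsing_inv (1 - F)
      ((Matrix.isUnit_iff_isUnit_det _).1 (isUnit_one_sub_adjMatrix hN β))
    rw [← hX, sub_mul, one_mul] at this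
    rw [← this, sub_add_cancel]
  have hU : IsUnit (1 - P * F * P) := by
    obtain ⟨g, hg⟩ := hN.exists_port_height (K := K)
    refine isUnit_one_sub_of_lt _ g fun x y hxy => hg β x y fun h0 => hxy ?_
    rw [hP, cutProj, Matrix.mul_diagonal, Matrix.diagonal_mul, show F x y = 0 from h0]
    simp
  -- From `X = 1 + F X`, with `F X` split as `F P X + F (1 - P) X`.
  have hPXQ : (1 - P * F * P) * (P * X * (1 - P)) = P * F * (1 - P) * (X * (1 - P)) := by
    have h1 : P * X * (1 - P) = P * F * X * (1 - P) := by
      conv_lhs => rw [hXF]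
      have : P * (1 - P) = 0 := by rw [mul_sub, hPP, mul_one, sub_self]
      rw [mul_add, mul_one, add_mul, this, zero_add, ← mul_assoc]
    have h2 : P * F * P * (P * X * (1 - P)) = P * F * P * X * (1 - P) := by
      simp only [← mul_assoc]
      rw [mul_assoc (P * F) P P, hPP]
    rw [sub_mul, one_mul, h2, h1]
    simp only [mul_sub, sub_mul, mul_one, mul_assoc]
    abel
  have hM : N.systemMatrix S T α β ε = N.encMatrix S α * (1 - P * F * P)⁻¹ *
      (P * F * (1 - P)) * (X * (1 - P) * (N.decMatrix T ε).transpose) := by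
    have h1 : P * X * (1 - P) =
        (1 - P * F * P)⁻¹ * (P * F * (1 - P) * (X * (1 - P))) := by
      rw [← hPXQ, Matrix.nonsing_inv_mul_cancel_left _ _
        ((Matrix.isUnit_iff_isUnit_det _).1 hU)]
    calc N.systemMatrix S T α β ε
        = (N.encMatrix S α * P) * X * ((1 - P) * (N.decMatrix T ε).transpose) := by
          rw [hA, hB]; rfl
      _ = N.encMatrix S α * (P * X * (1 - P)) * (N.decMatrix T ε).transpose := by
          simp only [Matrix.mul_assoc]
      _ = _ := by
          rw [h1]
          simp only [Matrix.mul_assoc]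
  rw [hM]
  exact ((Matrix.rank_mul_le_left _ _).trans (Matrix.rank_mul_le_right _ _)).trans
    (rank_cutProj_adjMatrix_le N β Ω)

end UpperBound

/-! ### Coefficients attaining the minimum cut. -/

section LowerBound

variable {K V I O : Type*} [Field K] [DecidableEq V] [Fintype I] [DecidableEq I]
  [Fintype O] [DecidableEq O]

/-- The incidence matrix of all output ports against all input ports. -/
def edgeMatrix (N : ADTNetwork V I O) (K : Type*) [Field K] : Matrix O I K :=
  Matrix.of fun o i => if (o, i) ∈ N.edges then 1 else 0

theorem inv_one_sub_adjMatrix (N : ADTNetwork V I O) {β : Matrix I O K}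
    (hβ : ∀ i o, N.inNode i ≠ N.outNode o → β i o = 0) (hu : IsUnit (1 - N.adjMatrix β)) :
    ∃ W : Matrix O I K, W * (1 - β * N.edgeMatrix K) = N.edgeMatrix K ∧
      ∀ o i, (1 - N.adjMatrix β)⁻¹ (.inr o) (.inl i) = W o i := by
  set E := N.edgeMatrix K with hE
  have hF : 1 - N.adjMatrix β = Matrix.fromBlocks 1 (-β) (-E) 1 := by
    ext (i | o) (i' | o')
    · simp [adjMatrix, Matrix.one_apply]
    · by_cases h : N.inNode i = N.outNode o' <;> simp [adjMatrix, h, hβ]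
    · simp [adjMatrix, hE, edgeMatrix]
    · simp [adjMatrix, Matrix.one_apply]
  have hd : IsUnit (1 - β * E).det := by
    rw [Matrix.isUnit_iff_isUnit_det, hF, Matrix.det_fromBlocks_one₂₂] at hu
    simpa using hu
  set W := E * (1 - β * E)⁻¹ with hW
  have hWE : W * (1 - β * E) = E := Matrix.nonsing_inv_mul_cancel_right _ _ hd
  refine ⟨W, hWE, fun o i => ?_⟩
  have hWβE : W * (β * E) = W - E := by
    rw [Matrix.mul_sub, Matrix.mul_one] at hWE
    exact eq_sub_of_add_eq (sub_eq_iff_eq_add'.1 hWE).symm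
  -- Block inversion by the Schur complement `1 - β E`.
  have hinv : (1 - N.adjMatrix β)⁻¹ =
      Matrix.fromBlocks (1 + β * W) ((1 + β * W) * β) W (1 + W * β) := by
    apply Matrix.inv_eq_left_inv
    rw [hF, Matrix.fromBlocks_multiply, ← Matrix.fromBlocks_one]
    congr 1
    · simp only [Matrix.mul_one, Matrix.mul_neg, Matrix.add_mul, Matrix.one_mul, Matrix.mul_assoc, hWβE,
        Matrix.mul_sub]
      abel
    · simp
    · simp only [Matrix.mul_one, Matrix.mul_neg, Matrix.add_mul, Matrix.one_mul, Matrix.mul_assoc, hWβE]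
      abel
    · simp
  rw [hinv, Matrix.fromBlocks_apply₂₁]

theorem exists_coding_rank_ge [Finite V] (N : ADTNetwork V I O) {S T : V} (hST : S ≠ T) {r : ℕ}
    (hr : ∀ Ω, IsCut S T Ω → r ≤ (N.cutMatrix K Ω).rank) :
    ∃ β : Matrix I O K, (∀ i o, N.inNode i ≠ N.outNode o → β i o = 0) ∧
      ∀ W : Matrix O I K, W * (1 - β * N.edgeMatrix K) = N.edgeMatrix K →
        r ≤ (W.submatrix (Subtype.val : {o // N.outNode o = S} → O)
          (Subtype.val : {i // N.inNode i = T} → I)).rank := by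
  set E := N.edgeMatrix K with hE
  have hinit : ∀ Ω, IsCut S T Ω → r + (settled N.inNode ∅ Ω).card ≤
      finrank K (cutSpan K N.outNode N.inNode E.row (fun i => Pi.single i 1) ⊥ Ω) := by
    intro Ω hΩ
    have hset : ({i | N.inNode i ∈ Ω} : Set I) = settled N.inNode ∅ Ω := by
      ext i
      simp [settled]
    have := finrank_span_rows_sup_span_single E (fun o => N.outNode o ∈ Ω)
      (settled N.inNode ∅ Ω)
    rw [← hset] at this
    rw [cutSpan, sup_bot_eq, this]
    refine Nat.add_le_add_right ((hr Ω hΩ).trans ?_) _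
    exact Matrix.rank_submatrix_le (E.submatrix (Subtype.val : {o // N.outNode o ∈ Ω} → O)
      (Subtype.val : {i // i ∉ settled N.inNode ∅ Ω} → I)) id
      (fun i : {i // N.inNode i ∉ Ω} => ⟨i.1, by simpa [settled] using i.2⟩)
  set D : Finset I := {i | N.inNode i ≠ T} with hD
  obtain ⟨(β : Matrix I O K), hβ, h⟩ := exists_coding N.outNode N.inNode E hinit D
    (by simp [hD])
  refine ⟨β, hβ, fun W hW => ?_⟩
  have h1 := h {S} ⟨Finset.mem_singleton_self S, by simp [hST.symm]⟩
  have hs : settled N.inNode D {S} = D := by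
    ext i
    simp only [settled, hD, Finset.mem_singleton, Finset.mem_filter, Finset.mem_univ, true_and,
      or_iff_right_iff_imp]
    rintro rfl
    exact hST
  rw [hs] at h1
  set G := span K (W.row '' {o | N.outNode o = S}) ⊔
    span K ((fun i => (Pi.single i 1 : I → K)) '' D) with hG
  -- `ψ` sends rows of `W` to rows of `E` and unit vectors to reduced rows, so `G` is at least as
  -- large as the span controlled by `h1`.
  set ψ := (1 - β * E).vecMulLinear with hψ
  have hout : ∀ o, N.outNode o = S → E.row o ∈ G.map ψ := fun o ho =>
    ⟨W.row o, mem_sup_left (subset_span ⟨o, ho, rfl⟩), congrFun hW o⟩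
  have hred : ∀ i, reducedRow E β i = (1 - β * E).row i := by
    intro i
    ext k
    simp [reducedRow, Matrix.mul_apply, Matrix.one_apply, Pi.single_apply, eq_comm]
  have hin : ∀ i ∈ D, reducedRow E β i ∈ G.map ψ := by
    intro i hi
    refine ⟨Pi.single i 1, mem_sup_right (subset_span ⟨i, hi, rfl⟩), ?_⟩
    rw [hred, hψ, Matrix.vecMulLinear_apply, Matrix.single_one_vecMul]
  have hle : cutSpan K N.outNode N.inNode E.row (fun i => Pi.single i 1)
      (span K (reducedRow E β '' D)) {S} ≤ G.map ψ := by
    refine cutSpan_le (fun o ho => hout o (Finset.mem_singleton.1 ho)) (fun i hi => ?_) ?_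
    · rw [Finset.mem_singleton] at hi
      have : (Pi.single i 1 : I → K) = reducedRow E β i + ∑ o, β i o • E.row o := by
        simp [reducedRow]
      rw [this]
      refine add_mem (hin i (by simp [hD, hi, hST])) (sum_mem fun o _ => ?_)
      by_cases ho : N.outNode o = S
      · exact smul_mem _ _ (hout o ho)
      · rw [hβ i o (by rw [hi]; exact Ne.symm ho), zero_smul]
        exact zero_mem _
    · rw [span_le]
      rintro _ ⟨i, hi, rfl⟩
      exact hin i hi
  have h2 := (finrank_mono hle).trans (finrank_map_le ψ G)
  rw [hG, finrank_span_rows_sup_span_single W (fun o => N.outNode o = S) D] at h2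
  refine (Nat.le_of_add_le_add_right (h1.trans h2)).trans ?_
  exact Matrix.rank_submatrix_le (W.submatrix (Subtype.val : {o // N.outNode o = S} → O)
    (Subtype.val : {i // N.inNode i = T} → I)) id
    (fun i : {i // i ∉ D} => ⟨i.1, by simpa [hD] using i.2⟩)

theorem le_rank_systemMatrix (N : ADTNetwork V I O) {S T : V} {β : I → O → K} {W : Matrix O I K}
    (hW : ∀ o i, (1 - N.adjMatrix β)⁻¹ (.inr o) (.inl i) = W o i) {r m n : ℕ}
    (hr : r ≤ (W.submatrix (Subtype.val : {o // N.outNode o = S} → O)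
          (Subtype.val : {i // N.inNode i = T} → I)).rank) (hm : r ≤ m) (hn : r ≤ n) :
    ∃ (α : Fin m → O → K) (ε : I → Fin n → K), r ≤ (N.systemMatrix S T α β ε).rank := by
  obtain ⟨f, g, hfg⟩ := exists_submatrix_rank_eq _ hr
  -- The first `r` processes select the ports of a rank-`r` submatrix of the `S`-`T` block; the
  -- surplus processes are zero.
  set α : Fin m → O → K := fun k o =>
    if h : k.1 < r then (Pi.single (f ⟨k, h⟩).1 1 : O → K) o else 0 with hα
  set ε : I → Fin n → K := fun i k =>
    if h : k.1 < r then (Pi.single (g ⟨k, h⟩).1 1 : I → K) i else 0 with hε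
  refine ⟨α, ε, ?_⟩
  have hA : ∀ k : Fin r, N.encMatrix S α (Fin.castLE hm k) = Pi.single (.inr (f k).1) 1 := by
    intro k
    ext (i | o)
    · simp [encMatrix]
    · by_cases ho : o = (f k).1
      · subst ho
        simp [encMatrix, hα, (f k).2]
      · simp [encMatrix, hα, ho]
  have hB : ∀ k : Fin r, N.decMatrix T ε (Fin.castLE hn k) = Pi.single (.inl (g k).1) 1 := by
    intro k
    ext (i | o)
    · by_cases hi : i = (g k).1
      · subst hi
        simp [decMatrix, hε, (g k).2]
      · simp [decMatrix, hε, hi]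
    · simp [decMatrix]
  have hM : (N.systemMatrix S T α β ε).submatrix (Fin.castLE hm) (Fin.castLE hn) =
      (W.submatrix (Subtype.val : {o // N.outNode o = S} → O)
          (Subtype.val : {i // N.inNode i = T} → I)).submatrix f g := by
    ext k l
    rw [Matrix.submatrix_apply, systemMatrix, Matrix.mul_apply_eq_vecMul,
      Matrix.mul_apply_eq_vecMul, hA, Matrix.single_one_vecMul]
    change _ ⬝ᵥ N.decMatrix T ε (Fin.castLE hn l) = _
    rw [hB, dotProduct_single_one]
    exact hW _ _
  rw [← hfg, ← hM]
  exact Matrix.rank_submatrix_le _ _ _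

end LowerBound

end ADTNetwork

theorem mainTheorem1 {K : Type*} [Field K] [Finite K]
    {V I O : Type*} [Fintype V] [DecidableEq V] [Fintype I] [DecidableEq I]
    [Fintype O] [DecidableEq O]
    (N : ADTNetwork V I O) (hN : N.Acyclic) (S T : V) (hST : S ≠ T) :
    IsLeast (N.cutValues K S T) (N.mincut K S T) ∧
    (∀ β : I → O → K, IsUnit (1 - N.adjMatrix β)) ∧
    ∀ m n : ℕ, N.mincut K S T ≤ m → N.mincut K S T ≤ n →
      IsGreatest
        {r : ℕ | ∃ (α : Fin m → O → K) (β : I → O → K) (ε : I → Fin n → K),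
          r = (N.systemMatrix S T α β ε).rank}
        (N.mincut K S T) := by
  have hmem : N.mincut K S T ∈ N.cutValues K S T :=
    Nat.sInf_mem ⟨_, {S}, ⟨Finset.mem_singleton_self S, by simp [hST.symm]⟩, rfl⟩
  have hle : ∀ r ∈ N.cutValues K S T, N.mincut K S T ≤ r := fun r hr => Nat.sInf_le hr
  have hunit := fun β : I → O → K => ADTNetwork.isUnit_one_sub_adjMatrix hN β
  refine ⟨⟨hmem, hle⟩, hunit, fun m n hm hn => ?_⟩
  obtain ⟨Ω, hΩ, hΩr⟩ := hmem
  have hub : ∀ (α : Fin m → O → K) (β : I → O → K) (ε : I → Fin n → K),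
      (N.systemMatrix S T α β ε).rank ≤ N.mincut K S T := fun α β ε =>
    (ADTNetwork.rank_systemMatrix_le hN hΩ α β ε).trans hΩr.ge
  obtain ⟨β, hβ, hW⟩ := N.exists_coding_rank_ge (K := K) hST
    fun Ω' hΩ' => hle _ ⟨Ω', hΩ', rfl⟩
  obtain ⟨W, hWE, hWinv⟩ := N.inv_one_sub_adjMatrix hβ (hunit β)
  obtain ⟨α, ε, hr⟩ := N.le_rank_systemMatrix hWinv (hW W hWE) hm hn
  refine ⟨⟨α, β, ε, le_antisymm hr (hub α β ε)⟩, ?_⟩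
  rintro _ ⟨α, β, ε, rfl⟩
  exact hub α β ε
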